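/- Let $\boldsymbol\pi=(\pi_0,\pi_1,\dots)$ be a probability distribution on $\{0,1,2,\dots\}$ (the prior, $\pi_n=\mathbb P(N=n)$, of the number $N$ of trials), and let $\boldsymbol p=(p_1,p_2,\dots)$ be a profile of success probabilities with $p_1=1$ and $0<p_k<1$ for $k>1$. For $k\ge 1$ and $n\ge k$ put $$s_0(k+1,n)=\prod_{j=k+1}^n(1-p_j),\qquad s_1(k+1,n)=s_0(k+1,n)\sum_{j=k+1}^n\frac{p_j}{1-p_j}$$ (so $s_0(k+1,k)=1$ and $s_1(k+1,k)=0$); these are the probabilities of zero, respectively one, success among the independent trials $k+1,\dots,n$. Let $$f_k(t)=\Big(\sum_{j=0}^\infty \pi_{k+j}\binom{k+j}{k}(1-t)^j\Big)^{-1},$$ $$\mathcal S_0(t,k)=f_k(t)\sum_{j=0}^\infty \pi_{k+j}\binom{k+j}{k}(1-t)^j s_0(k+1,k+j),$$ $$\mathcal S_1(t,k)=f_k(t)\sum_{j=1}^\infty \pi_{k+j}\binom{k+j}{k}(1-t)^j s_1(k+1,k+j).$$ When the $N$ trials occur at independent uniform times on $[0,1]$ and $N_t$ is the number of trials in $[0,t]$,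 these are, for $t>0$, the conditional probabilities given $N_t=k$ that exactly zero, respectively exactly one, of the trials after time $t$ is a success. Fix $k\ge1$ and suppose $\pi_k>0$. Let $D_k$ be the set of all $t\in[0,1]$ for which $\sum_{j}\pi_{k+j}\binom{k+j}{k}(1-t)^j<\infty$. Then $(0,1]\subseteq D_k$, all the series above converge for $t\in D_k$, and: (i) $\mathcal S_0(1,k)=1$ and $\mathcal S_1(1,k)=0$; (ii) $\mathcal S_0(t,k)$ is nondecreasing in $t\in D_k$, and it is strictly increasing in $t\in D_k$ if $\mathbb P(N>k)=\sum_{j=k+1}^\infty\pi_j>0$; (iii) there exists $a_k\in[0,1)$ such that $\operatorname{sgn}\big(\mathcal S_0(t,k)-\mathcal S_1(t,k)\big)=\operatorname{sgn}(t-a_k)$ for all $t\in(0,1]$. -/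

import Mathlib

namespace LastSuccess

/-- The distribution `π n = P(N = n)` of the number `N` of trials: a probability distribution
on `{0, 1, 2, …}`. -/
structure IsPrior (π : ℕ → ℝ) : Prop where
  nonneg : ∀ n, 0 ≤ π n
  hasSum_one : HasSum π 1

/-- A profile of success probabilities `p 1, p 2, …` (the value `p 0` plays no role). -/
structure IsSuccessProfile (p : ℕ → ℝ) : Prop where
  first : p 1 = 1
  pos : ∀ k, 1 < k → 0 < p k
  lt_one : ∀ k, 1 < k → p k < 1

/-- Probability of zero successes among the trials `m, …, n` (an empty product is `1`). -/
noncomputable def s0 (p : ℕ → ℝ) (m n : ℕ) : ℝ :=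
  ∏ j ∈ Finset.Icc m n, (1 - p j)

/-- Probability of exactly one success among the trials `m, …, n`, for `m ≥ 2`
(an empty sum is `0`). -/
noncomputable def s1 (p : ℕ → ℝ) (m n : ℕ) : ℝ :=
  s0 p m n * ∑ j ∈ Finset.Icc m n, p j / (1 - p j)

/-- The unnormalised posterior weight of `N = k + j` in the state `N_t = k`. -/
noncomputable def weight (π : ℕ → ℝ) (k : ℕ) (t : ℝ) (j : ℕ) : ℝ :=
  π (k + j) * ((k + j).choose k : ℝ) * (1 - t) ^ j

/-- The times `t ∈ [0, 1]` at which the posterior weights have a finite sum, so that they can be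
normalised to a probability distribution (when `π k > 0`). -/
def posteriorTimes (π : ℕ → ℝ) (k : ℕ) : Set ℝ :=
  {t | t ∈ Set.Icc (0 : ℝ) 1 ∧ Summable (weight π k t)}

/-- The normalisation function `f_k(t)` of the posterior
`P(N = k + j | N_t = k) = f_k(t) * weight π k t j`, `j ≥ 0`. -/
noncomputable def normalisation (π : ℕ → ℝ) (k : ℕ) (t : ℝ) : ℝ :=
  (∑' j : ℕ, weight π k t j)⁻¹

/-- Conditional probability that no success follows the state `(t, k)`. -/
noncomputable def S0 (π p : ℕ → ℝ) (t : ℝ) (k : ℕ) : ℝ :=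
  normalisation π k t * ∑' j : ℕ, weight π k t j * s0 p (k + 1) (k + j)

/-- Conditional probability that exactly one success follows the state `(t, k)`, `k ≥ 1`.
The sum runs over `j + 1 = 1, 2, …`. -/
noncomputable def S1 (π p : ℕ → ℝ) (t : ℝ) (k : ℕ) : ℝ :=
  normalisation π k t * ∑' j : ℕ, weight π k t (j + 1) * s1 p (k + 1) (k + (j + 1))

end LastSuccess

/-!
Given `N_t = k`, the law of the number `N - k` of remaining trials has weights proportional to
`π (k + j) * (k + j).choose k * (1 - t) ^ j`, a family with monotone likelihood ratio in `t`:
passing from `t` to a later `t'` multiplies the weights by `q ^ j` with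
`q = (1 - t') / (1 - t) < 1`. If a sequence changes sign at most once, from positive to negative,
such a damping favours its positive terms, so once its posterior mean is nonnegative it is positive
at all later times. For `s0 - x`, with `x` the value of `S0` at time `t`, this is the strict
monotonicity of `S0`. For `s0 - s1 = s0 * (1 - odds)`, where the sum of the odds of success
increases with the number of remaining trials, it shows that `S0 - S1` has at most one zero, and the
threshold `a_k` is obtained by continuity.
-/

namespace LastSuccess

section SingleCrossing

variable {a c : ℕ → ℝ} {q r u v : ℝ}

/-- A real sequence that changes sign at most once, from positive to negative: after a negative term
no term is positive. Zero terms are allowed anywhere, so that the notion is stable under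
multiplication by nonnegative sequences. -/
def IsSingleCrossing (a : ℕ → ℝ) : Prop :=
  ∀ ⦃i j⦄, i ≤ j → a i < 0 → a j ≤ 0

theorem isSingleCrossing_of_antitone (ha : Antitone a) : IsSingleCrossing a :=
  fun _ _ hij hi => (ha hij).trans hi.le

theorem IsSingleCrossing.mul_left (ha : IsSingleCrossing a) (hc : ∀ j, 0 ≤ c j) :
    IsSingleCrossing fun j => c j * a j :=
  fun i _ hij hi => mul_nonpos_of_nonneg_of_nonpos (hc _) (ha hij (neg_of_mul_neg_right hi (hc i)))

theorem IsSingleCrossing.exists_mul_le_mul_pow (ha : IsSingleCrossing a) (h0 : 0 ≤ a 0)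
    (hq0 : 0 ≤ q) (hq1 : q < 1) : ∃ κ ∈ Set.Ico (0 : ℝ) 1, ∀ j, κ * a j ≤ a j * q ^ j := by
  classical
  by_cases hneg : ∃ j, a j < 0
  · -- `κ = q ^ m` for the first negative index `m`: `q ^ j - q ^ m` has the sign of `a j`.
    have hm : Nat.find hneg ≠ 0 := fun h => h0.not_gt (h ▸ Nat.find_spec hneg)
    refine ⟨q ^ Nat.find hneg, ⟨pow_nonneg hq0 _, pow_lt_one₀ hq0 hq1 hm⟩, fun j => ?_⟩
    rw [mul_comm]
    rcases lt_or_ge j (Nat.find hneg) with hj | hj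
    · exact mul_le_mul_of_nonneg_left (pow_le_pow_of_le_one hq0 hq1.le hj.le)
        (not_lt.1 (Nat.find_min hneg hj))
    · exact mul_le_mul_of_nonpos_left (pow_le_pow_of_le_one hq0 hq1.le hj)
        (ha hj (Nat.find_spec hneg))
  · push Not at hneg
    exact ⟨0, by simp, fun j => by simpa using mul_nonneg (hneg j) (pow_nonneg hq0 j)⟩

theorem summable_mul_pow_of_lt (hu : 0 ≤ u) (huv : u < v) (hv : Summable fun j => a j * v ^ j) :
    Summable fun j => a j * u ^ j := by
  refine summable_powerSeries_of_norm_lt hv.hasSum.tendsto_sum_nat.cauchySeq ?_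
  rwa [Real.norm_of_nonneg hu, Real.norm_of_nonneg (hu.trans huv.le)]

theorem IsSingleCrossing.tsum_mul_pow_pos (ha : IsSingleCrossing a) (h0 : 0 < a 0) (hu : 0 ≤ u)
    (huv : u < v) (hv : Summable fun j => a j * v ^ j) (hnonneg : 0 ≤ ∑' j, a j * v ^ j) :
    0 < ∑' j, a j * u ^ j := by
  have hv0 : 0 < v := hu.trans_lt huv
  obtain ⟨κ, hκ, hle⟩ := ha.exists_mul_le_mul_pow h0.le (div_nonneg hu hv0.le)
    ((div_lt_one hv0).2 huv)
  have hterm : ∀ j, κ * (a j * v ^ j) ≤ a j * u ^ j := fun j =>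
    calc κ * (a j * v ^ j) = κ * a j * v ^ j := (mul_assoc _ _ _).symm
      _ ≤ a j * (u / v) ^ j * v ^ j := mul_le_mul_of_nonneg_right (hle j) (by positivity)
      _ = a j * u ^ j := by rw [mul_assoc, ← mul_pow, div_mul_cancel₀ _ hv0.ne']
  have hterm0 : κ * (a 0 * v ^ 0) < a 0 * u ^ 0 := by
    simpa only [pow_zero, mul_one] using mul_lt_of_lt_one_left h0 hκ.2
  calc 0 ≤ κ * ∑' j, a j * v ^ j := mul_nonneg hκ.1 hnonneg
    _ = ∑' j, κ * (a j * v ^ j) := tsum_mul_left.symm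
    _ < ∑' j, a j * u ^ j := Summable.tsum_lt_tsum (i := 0) hterm hterm0 (hv.mul_left κ)
        (summable_mul_pow_of_lt hu huv hv)

theorem continuousOn_tsum_mul_pow (hv : Summable fun j => a j * v ^ j) :
    ContinuousOn (fun u : ℝ => ∑' j, a j * u ^ j) (Metric.closedBall 0 |v|) := by
  refine continuousOn_tsum (fun j => by fun_prop) hv.norm fun j u hu => ?_
  rw [mem_closedBall_zero_iff, Real.norm_eq_abs] at hu
  simp only [norm_mul, norm_pow, Real.norm_eq_abs]
  gcongr

theorem IsSingleCrossing.exists_sign_tsum_mul_pow_eq (ha : IsSingleCrossing a) (h0 : 0 < a 0)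
    (hr : 0 < r) (hs : ∀ u ∈ Set.Ico 0 r, Summable fun j => a j * u ^ j) :
    ∃ b ∈ Set.Ioc 0 r, ∀ u ∈ Set.Ico 0 r,
      SignType.sign (∑' j, a j * u ^ j) = SignType.sign (b - u) := by
  by_cases hpos : ∀ u ∈ Set.Ico 0 r, 0 < ∑' j, a j * u ^ j
  · exact ⟨r, ⟨hr, le_rfl⟩, fun u hu => by rw [sign_pos (hpos u hu), sign_pos (sub_pos.2 hu.2)]⟩
  push Not at hpos
  obtain ⟨v, hv, hfv⟩ := hpos
  have hf0 : ∑' j, a j * (0 : ℝ) ^ j = a 0 := by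
    rw [tsum_eq_single 0 fun j hj => by rw [zero_pow hj, mul_zero], pow_zero, mul_one]
  have hcont : ContinuousOn (fun u : ℝ => ∑' j, a j * u ^ j) (Set.Icc 0 v) :=
    (continuousOn_tsum_mul_pow (hs v hv)).mono fun u hu => by
      simpa [abs_of_nonneg hu.1, abs_of_nonneg hv.1] using hu.2
  obtain ⟨b, hb, hfb⟩ : ∃ b ∈ Set.Icc 0 v, ∑' j, a j * b ^ j = 0 :=
    intermediate_value_Icc' hv.1 hcont ⟨hfv, hf0 ▸ h0.le⟩
  have hbr : b < r := hb.2.trans_lt hv.2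
  have hb0 : 0 < b := by
    refine hb.1.lt_of_ne ?_
    rintro rfl
    exact h0.ne' (hf0.symm.trans hfb)
  refine ⟨b, ⟨hb0, hbr.le⟩, fun u hu => ?_⟩
  rcases lt_trichotomy u b with hub | rfl | hub
  · rw [sign_pos (sub_pos.2 hub),
      sign_pos (ha.tsum_mul_pow_pos h0 hu.1 hub (hs b ⟨hb.1, hbr⟩) hfb.ge)]
  · rw [hfb, sub_self]
  · have hfu : ∑' j, a j * u ^ j < 0 := by
      by_contra! hcon
      exact (ha.tsum_mul_pow_pos h0 hb.1 hub (hs u hu) hcon).ne' hfb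
    rw [sign_neg (sub_neg.2 hub), sign_neg hfu]

end SingleCrossing

theorem one_add_sum_le_prod_one_add {ι R : Type*} [CommSemiring R] [PartialOrder R]
    [IsOrderedRing R] (s : Finset ι) {x : ι → R} (hx : ∀ i ∈ s, 0 ≤ x i) :
    1 + ∑ i ∈ s, x i ≤ ∏ i ∈ s, (1 + x i) := by
  induction s using Finset.cons_induction with
  | empty => simp
  | cons i s hi ih =>
    have hx_i : 0 ≤ x i := hx i (Finset.mem_cons_self i s)
    have hx_s : ∀ j ∈ s, 0 ≤ x j := fun j hj => hx j (Finset.mem_cons_of_mem hj)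
    rw [Finset.sum_cons, Finset.prod_cons]
    calc 1 + (x i + ∑ j ∈ s, x j)
        ≤ 1 + (x i + ∑ j ∈ s, x j) + x i * ∑ j ∈ s, x j :=
          le_add_of_nonneg_right (mul_nonneg hx_i (Finset.sum_nonneg hx_s))
      _ = (1 + x i) * (1 + ∑ j ∈ s, x j) := by ring
      _ ≤ (1 + x i) * ∏ j ∈ s, (1 + x j) :=
          mul_le_mul_of_nonneg_left (ih hx_s) (add_nonneg zero_le_one hx_i)

section SuccessProbabilities

variable {p : ℕ → ℝ} {i m n : ℕ}

/-- The sum of the odds `p j / (1 - p j)` of success over the trials `m, …, n`, so that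
`s1 p m n = s0 p m n * sumOdds p m n` by definition. -/
noncomputable def sumOdds (p : ℕ → ℝ) (m n : ℕ) : ℝ :=
  ∑ j ∈ Finset.Icc m n, p j / (1 - p j)

theorem s0_of_lt (h : n < m) : s0 p m n = 1 := by
  rw [s0, Finset.Icc_eq_empty_of_lt h, Finset.prod_empty]

theorem sumOdds_of_lt (h : n < m) : sumOdds p m n = 0 := by
  rw [sumOdds, Finset.Icc_eq_empty_of_lt h, Finset.sum_empty]

theorem s1_of_lt (h : n < m) : s1 p m n = 0 :=
  mul_eq_zero_of_right _ (sumOdds_of_lt h)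

theorem s0_sub_s1 : s0 p m n - s1 p m n = s0 p m n * (1 - sumOdds p m n) := by
  rw [s1, ← sumOdds, mul_one_sub]

theorem s0_pos (hp : ∀ j ≥ m, p j < 1) : 0 < s0 p m n :=
  Finset.prod_pos fun j hj => sub_pos.2 (hp j (Finset.mem_Icc.1 hj).1)

theorem s0_antitone (hp : ∀ j ≥ m, p j ∈ Set.Icc 0 1) : Antitone (s0 p m) := fun _ _ hn =>
  Finset.prod_le_prod_of_subset_of_le_one (Finset.Icc_subset_Icc_right hn)
    (fun j hj => sub_nonneg.2 (hp j (Finset.mem_Icc.1 hj).1).2)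
    fun j hj _ => sub_le_self 1 (hp j (Finset.mem_Icc.1 hj).1).1

theorem s0_le_one (hp : ∀ j ≥ m, p j ∈ Set.Icc 0 1) : s0 p m n ≤ 1 :=
  Finset.prod_le_one (fun j hj => sub_nonneg.2 (hp j (Finset.mem_Icc.1 hj).1).2)
    fun j hj => sub_le_self 1 (hp j (Finset.mem_Icc.1 hj).1).1

theorem s0_lt_one (hp : ∀ j ≥ m, p j ∈ Set.Ico 0 1) (hi : i ∈ Finset.Icc m n) (hpi : 0 < p i) :
    s0 p m n < 1 :=
  calc s0 p m n < ∏ _j ∈ Finset.Icc m n, 1 :=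
        Finset.prod_lt_prod (fun j hj => sub_pos.2 (hp j (Finset.mem_Icc.1 hj).1).2)
          (fun j hj => sub_le_self 1 (hp j (Finset.mem_Icc.1 hj).1).1) ⟨i, hi, sub_lt_self 1 hpi⟩
    _ = 1 := Finset.prod_const_one

theorem odds_nonneg (hp : ∀ j ≥ m, p j ∈ Set.Icc 0 1) {j : ℕ} (hj : m ≤ j) :
    0 ≤ p j / (1 - p j) :=
  div_nonneg (hp j hj).1 (sub_nonneg.2 (hp j hj).2)

theorem sumOdds_monotone (hp : ∀ j ≥ m, p j ∈ Set.Icc 0 1) : Monotone (sumOdds p m) :=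
  fun _ _ hn => Finset.sum_le_sum_of_subset_of_nonneg (Finset.Icc_subset_Icc_right hn)
    fun _ hj _ => odds_nonneg hp (Finset.mem_Icc.1 hj).1

theorem s1_nonneg (hp : ∀ j ≥ m, p j ∈ Set.Icc 0 1) : 0 ≤ s1 p m n :=
  mul_nonneg (Finset.prod_nonneg fun j hj => sub_nonneg.2 (hp j (Finset.mem_Icc.1 hj).1).2)
    (Finset.sum_nonneg fun _ hj => odds_nonneg hp (Finset.mem_Icc.1 hj).1)

theorem s0_add_s1_le_one (hp : ∀ j ≥ m, p j ∈ Set.Ico 0 1) : s0 p m n + s1 p m n ≤ 1 := by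
  have hodds : ∀ j ∈ Finset.Icc m n, 0 ≤ p j / (1 - p j) := fun j hj =>
    odds_nonneg (fun i hi => Set.Ico_subset_Icc_self (hp i hi)) (Finset.mem_Icc.1 hj).1
  calc s0 p m n + s1 p m n = s0 p m n * (1 + ∑ j ∈ Finset.Icc m n, p j / (1 - p j)) := by
        rw [s1, mul_one_add]
    _ ≤ s0 p m n * ∏ j ∈ Finset.Icc m n, (1 + p j / (1 - p j)) :=
        mul_le_mul_of_nonneg_left (one_add_sum_le_prod_one_add _ hodds)
          (s0_pos fun j hj => (hp j hj).2).le
    _ = ∏ j ∈ Finset.Icc m n, (1 - p j) * (1 + p j / (1 - p j)) := Finset.prod_mul_distrib.symm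
    _ = 1 := Finset.prod_eq_one fun j hj => by
        have : 1 - p j ≠ 0 := (sub_pos.2 (hp j (Finset.mem_Icc.1 hj).1).2).ne'
        field_simp
        ring

theorem abs_s0_le_one (hp : ∀ j ≥ m, p j ∈ Set.Ico 0 1) : |s0 p m n| ≤ 1 := by
  rw [abs_of_pos (s0_pos fun j hj => (hp j hj).2)]
  exact s0_le_one fun j hj => Set.Ico_subset_Icc_self (hp j hj)

theorem abs_s1_le_one (hp : ∀ j ≥ m, p j ∈ Set.Ico 0 1) : |s1 p m n| ≤ 1 := by
  rw [abs_of_nonneg (s1_nonneg fun j hj => Set.Ico_subset_Icc_self (hp j hj))]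
  linarith [s0_add_s1_le_one (n := n) hp, s0_pos (n := n) fun j hj => (hp j hj).2]

theorem isSingleCrossing_s0_sub_s1 (hp : ∀ j ≥ m, p j ∈ Set.Ico 0 1) (l : ℕ) :
    IsSingleCrossing fun j => s0 p m (l + j) - s1 p m (l + j) := by
  have hodds : Antitone fun j => 1 - sumOdds p m (l + j) := fun _ _ hij => sub_le_sub_left
    (sumOdds_monotone (fun j hj => Set.Ico_subset_Icc_self (hp j hj)) (Nat.add_le_add_left hij l)) 1
  simp only [s0_sub_s1]
  exact (isSingleCrossing_of_antitone hodds).mul_left fun j => (s0_pos fun i hi => (hp i hi).2).le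

end SuccessProbabilities

section Posterior

variable {π a b : ℕ → ℝ} {k j : ℕ} {t t' C : ℝ}

/-- The mean `E[a (N - k) | N_t = k]` of a function of the remaining number of trials under the
posterior distribution of `N`. It has the junk value `0` where the weights are not summable. -/
noncomputable def posteriorMean (π : ℕ → ℝ) (k : ℕ) (t : ℝ) (a : ℕ → ℝ) : ℝ :=
  normalisation π k t * ∑' j, weight π k t j * a j

theorem weight_zero_right : weight π k t 0 = π k := by simp [weight]

theorem weight_one_of_ne_zero (hj : j ≠ 0) : weight π k 1 j = 0 := by simp [weight, hj]

theorem weight_eq_mul_pow : weight π k t j = weight π k 0 j * (1 - t) ^ j := by simp [weight]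

theorem weight_nonneg (hπ : ∀ n, 0 ≤ π n) (ht : t ≤ 1) : 0 ≤ weight π k t j :=
  mul_nonneg (mul_nonneg (hπ _) (Nat.cast_nonneg _)) (pow_nonneg (sub_nonneg.2 ht) j)

theorem weight_pos (hj : 0 < π (k + j)) (ht : t < 1) : 0 < weight π k t j :=
  mul_pos (mul_pos hj (Nat.cast_pos.2 (Nat.choose_pos (Nat.le_add_right k j))))
    (pow_pos (sub_pos.2 ht) j)

theorem Ioc_subset_posteriorTimes (hπ : ∀ n, 0 ≤ π n) (hbdd : BddAbove (Set.range π)) :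
    Set.Ioc (0 : ℝ) 1 ⊆ posteriorTimes π k := by
  rintro t ⟨ht0, ht1⟩
  obtain ⟨C, hC⟩ := hbdd
  have hnorm : ‖1 - t‖ < 1 := by
    rw [Real.norm_of_nonneg (sub_nonneg.2 ht1)]
    exact sub_lt_self 1 ht0
  refine ⟨⟨ht0.le, ht1⟩, ((summable_choose_mul_geometric_of_norm_lt_one k hnorm).mul_left
    C).of_nonneg_of_le (fun _ => weight_nonneg hπ ht1) fun j => ?_⟩
  rw [weight, add_comm k j, mul_assoc]
  exact mul_le_mul_of_nonneg_right (hC (Set.mem_range_self _))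
    (mul_nonneg (Nat.cast_nonneg _) (pow_nonneg (sub_nonneg.2 ht1) j))

theorem summable_weight_mul (hπ : ∀ n, 0 ≤ π n) (ht : t ∈ posteriorTimes π k)
    (ha : ∀ j, |a j| ≤ C) : Summable fun j => weight π k t j * a j := by
  refine (ht.2.mul_right C).of_norm_bounded fun j => ?_
  rw [norm_mul, Real.norm_of_nonneg (weight_nonneg hπ ht.1.2)]
  exact mul_le_mul_of_nonneg_left (ha j) (weight_nonneg hπ ht.1.2)

theorem tsum_weight_pos (hπ : ∀ n, 0 ≤ π n) (hπk : 0 < π k) (ht : t ∈ posteriorTimes π k) :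
    0 < ∑' j, weight π k t j :=
  ht.2.tsum_pos (fun _ => weight_nonneg hπ ht.1.2) 0 (weight_zero_right.symm ▸ hπk)

theorem sign_posteriorMean (hπ : ∀ n, 0 ≤ π n) (hπk : 0 < π k) (ht : t ∈ posteriorTimes π k) :
    SignType.sign (posteriorMean π k t a) = SignType.sign (∑' j, weight π k t j * a j) := by
  rw [posteriorMean, sign_mul, normalisation, sign_pos (inv_pos.2 (tsum_weight_pos hπ hπk ht)),
    one_mul]

theorem posteriorMean_const (hπ : ∀ n, 0 ≤ π n) (hπk : 0 < π k) (ht : t ∈ posteriorTimes π k)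
    (x : ℝ) : posteriorMean π k t (fun _ => x) = x := by
  rw [posteriorMean, normalisation, tsum_mul_right,
    inv_mul_cancel_left₀ (tsum_weight_pos hπ hπk ht).ne']

theorem posteriorMean_sub (ha : Summable fun j => weight π k t j * a j)
    (hb : Summable fun j => weight π k t j * b j) :
    posteriorMean π k t (fun j => a j - b j) = posteriorMean π k t a - posteriorMean π k t b := by
  simp only [posteriorMean, mul_sub, ha.tsum_sub hb]

theorem posteriorMean_one (hπk : π k ≠ 0) : posteriorMean π k 1 a = a 0 := by
  rw [posteriorMean, normalisation, tsum_eq_single 0 fun j hj => weight_one_of_ne_zero hj,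
    tsum_eq_single 0 fun j hj => by rw [weight_one_of_ne_zero hj, zero_mul], weight_zero_right,
    inv_mul_cancel_left₀ hπk]

theorem posteriorMean_pos (hπ : ∀ n, 0 ≤ π n) (hπk : 0 < π k) (ht : t ∈ posteriorTimes π k)
    (ht1 : t < 1) (hs : Summable fun j => weight π k t j * a j) (ha : ∀ j, 0 ≤ a j)
    (hπj : 0 < π (k + j)) (haj : 0 < a j) : 0 < posteriorMean π k t a :=
  mul_pos (inv_pos.2 (tsum_weight_pos hπ hπk ht)) (hs.tsum_pos
    (fun i => mul_nonneg (weight_nonneg hπ ht.1.2) (ha i)) j (mul_pos (weight_pos hπj ht1) haj))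

theorem posteriorMean_lt (hπ : ∀ n, 0 ≤ π n) (hπk : 0 < π k) (ht : t ∈ posteriorTimes π k)
    (ht1 : t < 1) (hs : Summable fun j => weight π k t j * a j) {x : ℝ} (ha : ∀ j, a j ≤ x)
    (hπj : 0 < π (k + j)) (haj : a j < x) : posteriorMean π k t a < x := by
  have hx : Summable fun j => weight π k t j * x := ht.2.mul_right x
  have hpos : 0 < posteriorMean π k t fun i => x - a i :=
    posteriorMean_pos hπ hπk ht ht1 (by simpa only [mul_sub] using hx.sub hs)
      (fun i => sub_nonneg.2 (ha i)) hπj (sub_pos.2 haj)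
  rwa [posteriorMean_sub hx hs, posteriorMean_const hπ hπk ht, sub_pos] at hpos

theorem IsSingleCrossing.weight_mul (ha : IsSingleCrossing a) (hπ : ∀ n, 0 ≤ π n) (ht : t ≤ 1) :
    IsSingleCrossing fun j => weight π k t j * a j :=
  ha.mul_left fun _ => weight_nonneg hπ ht

theorem weight_mul_eq_mul_pow :
    (fun j => weight π k t j * a j) = fun j => weight π k 0 j * a j * (1 - t) ^ j :=
  funext fun j => by rw [weight_eq_mul_pow, mul_right_comm]

theorem IsSingleCrossing.posteriorMean_pos_of_lt (ha : IsSingleCrossing a) (h0 : 0 < a 0)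
    (hπ : ∀ n, 0 ≤ π n) (hπk : 0 < π k) (ht : t ∈ posteriorTimes π k)
    (ht' : t' ∈ posteriorTimes π k) (htt' : t < t')
    (hs : Summable fun j => weight π k t j * a j) (hnonneg : 0 ≤ posteriorMean π k t a) :
    0 < posteriorMean π k t' a := by
  rw [← sign_nonneg_iff, sign_posteriorMean hπ hπk ht, sign_nonneg_iff] at hnonneg
  rw [← sign_eq_one_iff, sign_posteriorMean hπ hπk ht', sign_eq_one_iff]
  rw [weight_mul_eq_mul_pow] at hs hnonneg ⊢
  exact (ha.weight_mul hπ zero_le_one).tsum_mul_pow_pos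
    (by rw [weight_zero_right]; exact mul_pos hπk h0) (sub_nonneg.2 ht'.1.2)
    (sub_lt_sub_left htt' 1) hs hnonneg

theorem posteriorMean_strictMonoOn (hπ : ∀ n, 0 ≤ π n) (hπk : 0 < π k) (ha : Antitone a)
    (hC : ∀ j, |a j| ≤ C) (hπj : 0 < π (k + j)) (haj : a j < a 0) :
    StrictMonoOn (fun t => posteriorMean π k t a) (posteriorTimes π k) := by
  intro t ht t' ht' htt'
  have hsummable {s : ℝ} (hs : s ∈ posteriorTimes π k) : Summable fun i => weight π k s i * a i :=
    summable_weight_mul hπ hs hC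
  have hconst {s : ℝ} (hs : s ∈ posteriorTimes π k) (x : ℝ) :
      Summable fun i => weight π k s i * x :=
    hs.2.mul_right x
  have hlt : posteriorMean π k t a < a 0 := posteriorMean_lt hπ hπk ht (htt'.trans_le ht'.1.2)
    (hsummable ht) (fun i => ha i.zero_le) hπj haj
  set x := posteriorMean π k t a with hx
  have hcross : IsSingleCrossing fun i => a i - x :=
    isSingleCrossing_of_antitone fun _ _ hij => sub_le_sub_right (ha hij) x
  have hmean {s : ℝ} (hs : s ∈ posteriorTimes π k) :
      posteriorMean π k s (fun i => a i - x) = posteriorMean π k s a - x := by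
    rw [posteriorMean_sub (hsummable hs) (hconst hs x), posteriorMean_const hπ hπk hs]
  have hpos := hcross.posteriorMean_pos_of_lt (sub_pos.2 hlt) hπ hπk ht ht' htt'
    (by simpa only [mul_sub] using (hsummable ht).sub (hconst ht x))
    (by rw [hmean ht, ← hx, sub_self])
  rwa [hmean ht', sub_pos] at hpos

theorem posteriorMean_monotoneOn (hπ : ∀ n, 0 ≤ π n) (hπk : 0 < π k) (ha : Antitone a)
    (hC : ∀ j, |a j| ≤ C) :
    MonotoneOn (fun t => posteriorMean π k t a) (posteriorTimes π k) := by
  by_cases h : ∃ j, 0 < π (k + j) ∧ a j < a 0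
  · obtain ⟨j, hπj, haj⟩ := h
    exact (posteriorMean_strictMonoOn hπ hπk ha hC hπj haj).monotoneOn
  push Not at h
  have hweight (t : ℝ) (j : ℕ) : weight π k t j * a j = weight π k t j * a 0 := by
    rcases (hπ (k + j)).eq_or_lt' with hj | hj
    · rw [weight, hj, zero_mul, zero_mul, zero_mul, zero_mul]
    · rw [(ha j.zero_le).antisymm (h j hj)]
  have hconst (t : ℝ) (ht : t ∈ posteriorTimes π k) : posteriorMean π k t a = a 0 := by
    rw [posteriorMean, tsum_congr (hweight t)]
    exact posteriorMean_const hπ hπk ht (a 0)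
  intro t ht t' ht' _
  exact (hconst t ht).trans_le (hconst t' ht').ge

theorem IsSingleCrossing.exists_sign_posteriorMean_eq (ha : IsSingleCrossing a) (h0 : 0 < a 0)
    (hπ : ∀ n, 0 ≤ π n) (hπk : 0 < π k) (hT : Set.Ioc (0 : ℝ) 1 ⊆ posteriorTimes π k)
    (hs : ∀ t ∈ Set.Ioc (0 : ℝ) 1, Summable fun j => weight π k t j * a j) :
    ∃ τ ∈ Set.Ico (0 : ℝ) 1, ∀ t ∈ Set.Ioc (0 : ℝ) 1,
      SignType.sign (posteriorMean π k t a) = SignType.sign (t - τ) := by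
  have hflip {t : ℝ} : 1 - t ∈ Set.Ico (0 : ℝ) 1 ↔ t ∈ Set.Ioc (0 : ℝ) 1 := by
    simp only [Set.mem_Ico, Set.mem_Ioc, sub_nonneg, sub_lt_self_iff, and_comm]
  obtain ⟨b, hb, hsign⟩ := (ha.weight_mul (k := k) hπ zero_le_one).exists_sign_tsum_mul_pow_eq
    (by rw [weight_zero_right]; exact mul_pos hπk h0) one_pos fun u hu => by
      have := hs (1 - u) (hflip.1 (by rwa [sub_sub_cancel]))
      rwa [weight_mul_eq_mul_pow, sub_sub_cancel] at this
  refine ⟨1 - b, hflip.2 hb, fun t ht => ?_⟩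
  rw [sign_posteriorMean hπ hπk (hT ht), weight_mul_eq_mul_pow, hsign (1 - t) (hflip.2 ht)]
  congr 1
  ring

end Posterior

section SuccessAfterTime

variable {π p : ℕ → ℝ} {k : ℕ} {t : ℝ}

theorem S0_eq_posteriorMean :
    S0 π p t k = posteriorMean π k t fun j => s0 p (k + 1) (k + j) :=
  rfl

theorem S1_eq_posteriorMean (hs : Summable fun j => weight π k t j * s1 p (k + 1) (k + j)) :
    S1 π p t k = posteriorMean π k t fun j => s1 p (k + 1) (k + j) := by
  rw [S1, posteriorMean, hs.tsum_eq_zero_add, add_zero, s1_of_lt k.lt_add_one, mul_zero, zero_add]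

theorem exists_sign_S0_sub_S1_eq (hπ : ∀ n, 0 ≤ π n) (hπk : 0 < π k)
    (hT : Set.Ioc (0 : ℝ) 1 ⊆ posteriorTimes π k) (hp : ∀ j > k, p j ∈ Set.Ico 0 1) :
    ∃ τ ∈ Set.Ico (0 : ℝ) 1, ∀ t ∈ Set.Ioc (0 : ℝ) 1,
      SignType.sign (S0 π p t k - S1 π p t k) = SignType.sign (t - τ) := by
  have hs0 (t : ℝ) (ht : t ∈ Set.Ioc (0 : ℝ) 1) :
      Summable fun j => weight π k t j * s0 p (k + 1) (k + j) :=
    summable_weight_mul hπ (hT ht) fun _ => abs_s0_le_one hp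
  have hs1 (t : ℝ) (ht : t ∈ Set.Ioc (0 : ℝ) 1) :
      Summable fun j => weight π k t j * s1 p (k + 1) (k + j) :=
    summable_weight_mul hπ (hT ht) fun _ => abs_s1_le_one hp
  have hdiff0 : 0 < s0 p (k + 1) (k + 0) - s1 p (k + 1) (k + 0) := by
    rw [add_zero, s0_of_lt k.lt_add_one, s1_of_lt k.lt_add_one, sub_zero]
    exact one_pos
  obtain ⟨τ, hτ, hsign⟩ := (isSingleCrossing_s0_sub_s1 hp k).exists_sign_posteriorMean_eq hdiff0
    hπ hπk hT fun t ht => by simpa only [mul_sub] using (hs0 t ht).sub (hs1 t ht)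
  refine ⟨τ, hτ, fun t ht => ?_⟩
  rw [S0_eq_posteriorMean, S1_eq_posteriorMean (hs1 t ht),
    ← posteriorMean_sub (hs0 t ht) (hs1 t ht), hsign t ht]

theorem IsPrior.bddAbove_range (hπ : IsPrior π) : BddAbove (Set.range π) :=
  ⟨1, Set.forall_mem_range.2 fun n => le_hasSum hπ.hasSum_one n fun i _ => hπ.nonneg i⟩

theorem IsSuccessProfile.mem_Ico (hp : IsSuccessProfile p) {j : ℕ} (hj : 1 < j) :
    p j ∈ Set.Ico 0 1 :=
  ⟨(hp.pos j hj).le, hp.lt_one j hj⟩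

theorem IsSuccessProfile.exists_s0_lt_one (hp : IsSuccessProfile p) (hk : 1 ≤ k)
    (hπ : 0 < ∑' j, π (k + 1 + j)) : ∃ j, 0 < π (k + j) ∧ s0 p (k + 1) (k + j) < 1 := by
  obtain ⟨i, hi⟩ : ∃ i, 0 < π (k + 1 + i) := by
    by_contra! hnonpos
    exact hπ.not_ge (tsum_nonpos hnonpos)
  refine ⟨1 + i, by rwa [← add_assoc], s0_lt_one (i := k + 1)
    (fun j hj => hp.mem_Ico (by lia)) (Finset.mem_Icc.2 (by lia)) (hp.pos _ (by lia))⟩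

end SuccessAfterTime

end LastSuccess

open LastSuccess in
theorem mainTheorem7_general (π p : ℕ → ℝ) (hπ : ∀ n, 0 ≤ π n) (hbdd : BddAbove (Set.range π))
    (k : ℕ) (hp : ∀ j > k, p j ∈ Set.Ico 0 1) (hπk : 0 < π k) :
    (Set.Ioc (0 : ℝ) 1 ⊆ posteriorTimes π k ∧
      ∀ t ∈ posteriorTimes π k,
        Summable (fun j : ℕ => weight π k t j * s0 p (k + 1) (k + j)) ∧
        Summable (fun j : ℕ => weight π k t (j + 1) * s1 p (k + 1) (k + (j + 1)))) ∧
    (S0 π p 1 k = 1 ∧ S1 π p 1 k = 0) ∧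
    (MonotoneOn (fun t : ℝ => S0 π p t k) (posteriorTimes π k) ∧
      ((∃ j, 0 < π (k + j) ∧ s0 p (k + 1) (k + j) < 1) →
        StrictMonoOn (fun t : ℝ => S0 π p t k) (posteriorTimes π k))) ∧
    (∃ a : ℝ, a ∈ Set.Ico (0 : ℝ) 1 ∧ ∀ t ∈ Set.Ioc (0 : ℝ) 1,
      SignType.sign (S0 π p t k - S1 π p t k) = SignType.sign (t - a)) := by
  have hT : Set.Ioc (0 : ℝ) 1 ⊆ posteriorTimes π k := Ioc_subset_posteriorTimes hπ hbdd
  have hs0 (j : ℕ) : |s0 p (k + 1) (k + j)| ≤ 1 := abs_s0_le_one hp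
  have hs1 (t : ℝ) (ht : t ∈ posteriorTimes π k) :
      Summable fun j => weight π k t j * s1 p (k + 1) (k + j) :=
    summable_weight_mul hπ ht fun _ => abs_s1_le_one hp
  have hanti : Antitone fun j => s0 p (k + 1) (k + j) := fun _ _ hij =>
    s0_antitone (fun j hj => Set.Ico_subset_Icc_self (hp j hj)) (Nat.add_le_add_left hij k)
  refine ⟨⟨hT, fun t ht =>
      ⟨summable_weight_mul hπ ht hs0, (summable_nat_add_iff 1).2 (hs1 t ht)⟩⟩, ⟨?_, ?_⟩,
    ⟨posteriorMean_monotoneOn hπ hπk hanti hs0, ?_⟩, exists_sign_S0_sub_S1_eq hπ hπk hT hp⟩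
  · rw [S0_eq_posteriorMean, posteriorMean_one hπk.ne', add_zero, s0_of_lt k.lt_add_one]
  · rw [S1_eq_posteriorMean (hs1 1 (hT ⟨one_pos, le_rfl⟩)), posteriorMean_one hπk.ne',
      add_zero, s1_of_lt k.lt_add_one]
  · rintro ⟨j, hπj, hj⟩
    exact posteriorMean_strictMonoOn hπ hπk hanti hs0 hπj (hj.trans_eq (s0_of_lt k.lt_add_one).symm)

theorem mainTheorem7 (π p : ℕ → ℝ) (hπ : LastSuccess.IsPrior π)
    (hp : LastSuccess.IsSuccessProfile p) (k : ℕ) (hk : 1 ≤ k) (hπk : 0 < π k) :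
    -- the posterior, `S0` and `S1` are given by convergent series, for all `t ∈ (0, 1]` at least
    (Set.Ioc (0 : ℝ) 1 ⊆ LastSuccess.posteriorTimes π k ∧
      ∀ t ∈ LastSuccess.posteriorTimes π k,
        Summable (fun j : ℕ => LastSuccess.weight π k t j * LastSuccess.s0 p (k + 1) (k + j)) ∧
        Summable (fun j : ℕ =>
          LastSuccess.weight π k t (j + 1) * LastSuccess.s1 p (k + 1) (k + (j + 1)))) ∧
    (LastSuccess.S0 π p 1 k = 1 ∧ LastSuccess.S1 π p 1 k = 0) ∧
    (MonotoneOn (fun t : ℝ => LastSuccess.S0 π p t k) (LastSuccess.posteriorTimes π k) ∧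
      (0 < ∑' j : ℕ, π (k + 1 + j) →
        StrictMonoOn (fun t : ℝ => LastSuccess.S0 π p t k) (LastSuccess.posteriorTimes π k))) ∧
    (∃ a : ℝ, a ∈ Set.Ico (0 : ℝ) 1 ∧ ∀ t ∈ Set.Ioc (0 : ℝ) 1,
      SignType.sign (LastSuccess.S0 π p t k - LastSuccess.S1 π p t k) =
        SignType.sign (t - a)) := by
  obtain ⟨hconv, hone, ⟨hmono, hstrict⟩, hsign⟩ := mainTheorem7_general π p hπ.nonneg
    hπ.bddAbove_range k (fun _ hj => hp.mem_Ico (hk.trans_lt hj)) hπk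
  exact ⟨hconv, hone, ⟨hmono, fun h => hstrict (hp.exists_s0_lt_one hk h)⟩, hsign⟩
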